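/- **Setting.** Let $a,b>0$ and let $(\gamma)$ be a non-increasing curve in the first quadrant of the $st$-plane from $(a,0)$ to $(0,b)$, meeting the coordinate axes only at these two points, parametrized by arc length $\mu\in[0,L]$ measured from $(a,0)$. Let $P_0=(a,0),P_1,\dots,P_{N+1}=(0,b)$ be points ("vertices") in this order on $(\gamma)$ such that each arc of $(\gamma)$ between consecutive vertices is $C^2$ up to its end points and is either a horizontal segment, or a vertical segment, or contains no horizontal and no vertical segment. For $P=(s(P),t(P))$ let $W(P)=[0,s(P)]\times[0,t(P)]$; let $G=\bigcup_{P\in(\gamma)}W(P)$ be the region bounded by the axes and $(\gamma)$, and let $E(s,t)=\{(\sigma,\tau)\in G:(s,t)\in W(\sigma,\tau)\}$, $\gamma(s,t)=\{(\sigma,\tau)\in(\gamma):(s,t)\in W(\sigma,\tau)\}$. Let $(n_1,n_2)$ be the exterior unit normal on $(\gamma)$ and $\varphi_\mu=-n_2\varphi_s+n_1\varphi_t$. Let $f(s,t,x,p,q,u)\in\mathbb R^n$ be of class $C^1$, let $\Phi(s,t,x,p,q,u)$ and $\Phi_1(s,t,x,\eta)$ be real functions of class $C^2$, and let $\Phi_0(P,x)$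 be of class $C^1$ in $x\in\mathbb R^n$. Let the control $u$ (with values in $\mathbb R^m$) be $C^1$ and the state $x$ (with values in $\mathbb R^n$) be $C^2$ on a neighbourhood of $G$, with $x_{st}=f(s,t,x,x_s,x_t,u)$ on $(\operatorname{int}G)\cup(\gamma)$. All partial derivatives of $f,\Phi,\Phi_1,\Phi_0$ below are evaluated along $x,u$, with $p=x_s$, $q=x_t$, $\eta=x_\mu$; repeated upper and lower indices are summed; $\frac{D}{Ds},\frac{D}{Dt},\frac{D}{D\mu}$ are total derivatives. Let $R^i_j(s,t,\sigma,\tau)$, $(s,t)\in G$, $(\sigma,\tau)\in W(s,t)$, be the Riemann matrix: it is continuous, has continuous partial derivatives in $s$ and in $t$, and satisfies $$\partial_s\partial_tR^i_j=f^i_{x^k}R^k_j+f^i_{p^k}\partial_sR^k_j+f^i_{q^k}\partial_tR^k_j,$$ $$\partial_sR^i_j(s,\tau,\sigma,\tau)=f^i_{q^k}R^k_j(s,\tau,\sigma,\tau),\quad \partial_tR^i_j(\sigma,t,\sigma,\tau)=f^i_{p^k}R^k_j(\sigma,t,\sigma,\tau),\quad R^i_j(\sigma,\tau,\sigma,\tau)=\delta^i_j.$$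 Put $$F_i=\Phi_{x^i}-\tfrac{D}{Ds}\Phi_{p^i}-\tfrac{D}{Dt}\Phi_{q^i},\qquad F_{1,i}=n_1\Phi_{p^i}+n_2\Phi_{q^i}+\Phi_{1,x^i}-\tfrac{D}{D\mu}\Phi_{1,\eta^i},\qquad F_{0,i}(P_r)=\Phi_{0,x^i}(P_r,x(P_r))-V_r(\Phi_{1,\eta^i}),$$ where $V_r(\varphi)$ is the limit of $\varphi$ along $(\gamma)$ at $P_r$ from the side of larger $\mu$ minus the limit from the side of smaller $\mu$. The co-state is $$\psi_j(s,t)=\iint_{E(s,t)}F_iR^i_j(\sigma,\tau,s,t)\,dA(\sigma,\tau)+\int_{\gamma(s,t)}F_{1,i}R^i_j(\sigma,\tau,s,t)\,d\mu(\sigma,\tau)+\sum_{\substack{1\le r\le N\\(s,t)\in W(P_r)}}F_{0,i}(P_r)R^i_j(P_r,s,t).$$ For $P\in(\gamma)$ let $L_s(P)$ be the maximal horizontal segment of $(\gamma)$ consisting of points that precede $P$ (have smaller $\mu$) and ending at $P$, with $P$ itself excluded, and let $L_t(P)$ be the maximal vertical segment of $(\gamma)$ consisting of points subsequent to $P$ and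 starting at $P$, with $P$ itself excluded; either may be empty. Let $S(P)$ and $T(P)$ be the sets of vertices in $L_s(P)$ and in $L_t(P)$, respectively. Let $(S_r)$ be the line $t=t(P_r)$ and $(T_r)$ the line $s=s(P_r)$. Jumps are defined by $$\Omega_{(S_r)}\varphi(s,t)=\lim_{\tau\to t^-}\varphi(s,\tau)-\lim_{\tau\to t^+}\varphi(s,\tau),\qquad \Omega_{(T_r)}\varphi(s,t)=\lim_{\sigma\to s^-}\varphi(\sigma,t)-\lim_{\sigma\to s^+}\varphi(\sigma,t).$$ **Theorem 4.3.** All integrals over $E(s,t)$ and $\gamma(s,t)$ in the definition of $\psi$ converge absolutely for $(s,t)\in G$. The one-sided limits that define the following jumps exist, and for every $j$ and every $r\in\{0,\dots,N+1\}$: (1) if $P_q$ is the last vertex on the line $(S_r)$ (so that $q=r$ unless $P_r$ lies on a horizontal part of $(\gamma)$ and is not its last vertex), then for all $(s,t)\in(S_r)\cap\operatorname{int}G$ $$\Omega_{(S_r)}\psi_j(s,t)=\int_{L_s(P_q)}F_{1,i}R^i_j(\sigma,\tau,s,t)\,d\mu(\sigma,\tau)+\sum_{P_k\in S(P_q)\cup\{P_q\}}F_{0,i}(P_k)R^i_j(P_k,s,t);$$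 (2) if $P_q$ is the first vertex on the line $(T_r)$ (so that $q=r$ unless $P_r$ lies on a vertical part of $(\gamma)$ and is not its first vertex), then for all $(s,t)\in(T_r)\cap\operatorname{int}G$ $$\Omega_{(T_r)}\psi_j(s,t)=\int_{L_t(P_q)}F_{1,i}R^i_j(\sigma,\tau,s,t)\,d\mu(\sigma,\tau)+\sum_{P_k\in T(P_q)\cup\{P_q\}}F_{0,i}(P_k)R^i_j(P_k,s,t).$$ -/

import Mathlib

open Set Filter Topology MeasureTheory

noncomputable section

namespace GoursatDarboux

/-- Partial derivative with respect to `s` (the first coordinate of the `st`-plane). -/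
def partialS {E : Type*} [NormedAddCommGroup E] [NormedSpace ℝ E]
    (φ : ℝ × ℝ → E) (P : ℝ × ℝ) : E := fderiv ℝ φ P (1, 0)

/-- Partial derivative with respect to `t` (the second coordinate of the `st`-plane). -/
def partialT {E : Type*} [NormedAddCommGroup E] [NormedSpace ℝ E]
    (φ : ℝ × ℝ → E) (P : ℝ × ℝ) : E := fderiv ℝ φ P (0, 1)

/-- The rectangle `W(P) = {(σ, τ) : 0 ≤ σ ≤ s(P), 0 ≤ τ ≤ t(P)}`. -/
def rect (P : ℝ × ℝ) : Set (ℝ × ℝ) :=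
  {Q | 0 ≤ Q.1 ∧ Q.1 ≤ P.1 ∧ 0 ≤ Q.2 ∧ Q.2 ≤ P.2}

/-- The boundary curve `γ`, from `(a, 0)` to `(0, b)`, parametrized by arc length, together with
the arc-length parameters `mark 0 = 0 < mark 1 < ... < mark (N+1) = len` of the vertices
`P_0, ..., P_{N+1}`.  The curve is non-increasing and meets the coordinate axes only at its two end
points; it is `C²` (up to the end points) between consecutive vertices, and each arc between
consecutive vertices is either flat (horizontal or vertical) or oblique (it contains no horizontal
and no vertical segment). -/
structure CurvedDomain (N : ℕ) where
  a : ℝ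
  b : ℝ
  len : ℝ
  L₁ : ℝ → ℝ
  L₂ : ℝ → ℝ
  mark : Fin (N + 2) → ℝ
  a_pos : 0 < a
  b_pos : 0 < b
  mark_strictMono : StrictMono mark
  mark_zero : mark 0 = 0
  mark_last : mark (Fin.last (N + 1)) = len
  start_eq : L₁ 0 = a ∧ L₂ 0 = 0
  end_eq : L₁ len = 0 ∧ L₂ len = b
  pos : ∀ μ ∈ Ioo 0 len, 0 < L₁ μ ∧ 0 < L₂ μ
  antitone_L₁ : AntitoneOn L₁ (Icc 0 len)
  monotone_L₂ : MonotoneOn L₂ (Icc 0 len)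
  contDiff : ∀ r : Fin (N + 1),
    ContDiffOn ℝ 2 L₁ (Icc (mark r.castSucc) (mark r.succ)) ∧
    ContDiffOn ℝ 2 L₂ (Icc (mark r.castSucc) (mark r.succ))
  unit_speed : ∀ r : Fin (N + 1), ∀ μ ∈ Ioo (mark r.castSucc) (mark r.succ),
    deriv L₁ μ ^ 2 + deriv L₂ μ ^ 2 = 1
  flat_or_oblique : ∀ r : Fin (N + 1),
    (∀ μ ∈ Icc (mark r.castSucc) (mark r.succ), L₁ μ = L₁ (mark r.castSucc)) ∨
    (∀ μ ∈ Icc (mark r.castSucc) (mark r.succ), L₂ μ = L₂ (mark r.castSucc)) ∨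
    (StrictAntiOn L₁ (Icc (mark r.castSucc) (mark r.succ)) ∧
      StrictMonoOn L₂ (Icc (mark r.castSucc) (mark r.succ)))

namespace CurvedDomain

variable {N : ℕ} (D : CurvedDomain N)

/-- The point of `γ` with arc-length parameter `μ`. -/
def point (μ : ℝ) : ℝ × ℝ := (D.L₁ μ, D.L₂ μ)

/-- The curve `γ` as a set of points. -/
def curve : Set (ℝ × ℝ) := D.point '' Icc 0 D.len

/-- The vertex `P_r`. -/
def vertex (r : Fin (N + 2)) : ℝ × ℝ := D.point (D.mark r)

/-- The (closed) region `G` of the first quadrant that is bounded by the segment `[0, a]` of the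
`s`-axis, the segment `[0, b]` of the `t`-axis and the curve `γ`. -/
def G : Set (ℝ × ℝ) := {P | ∃ Q ∈ D.curve, P ∈ rect Q}

/-- `E(P) = {(σ, τ) ∈ G : P ∈ W(σ, τ)}`. -/
def E (P : ℝ × ℝ) : Set (ℝ × ℝ) := {Q | Q ∈ D.G ∧ P ∈ rect Q}

/-- `γ(P) = {(σ, τ) ∈ γ : P ∈ W(σ, τ)}`. -/
def arc (P : ℝ × ℝ) : Set (ℝ × ℝ) := {Q | Q ∈ D.curve ∧ P ∈ rect Q}

/-- First component of the exterior unit normal.  The unit tangent in the direction of increasing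
arc length (counterclockwise) is the pair of derivatives of `L₁, L₂`, and it equals `(-n₂, n₁)`. -/
def n₁ (μ : ℝ) : ℝ := deriv D.L₂ μ

/-- Second component of the exterior unit normal. -/
def n₂ (μ : ℝ) : ℝ := -deriv D.L₁ μ

/-- The set of arc-length parameters of the points of `γ` that lie in `A`.  Integrating over it
with respect to Lebesgue measure is integrating over `A ∩ γ` with respect to arc length. -/
def params (A : Set (ℝ × ℝ)) : Set ℝ := {μ | μ ∈ Icc 0 D.len ∧ D.point μ ∈ A}

/-- `Q` precedes `P` on `γ` in the counterclockwise orientation, i.e. going from `(a, 0)` to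
`(0, b)`. -/
def Precedes (Q P : ℝ × ℝ) : Prop :=
  ∃ μ ∈ Icc 0 D.len, ∃ ν ∈ Icc 0 D.len, μ < ν ∧ D.point μ = Q ∧ D.point ν = P

/-- `L_s(P)`: the maximal segment of `γ`, parallel to the `s`-axis, that consists of points
preceding `P` and issues from `P`; the point `P` itself is excluded. -/
def Ls (P : ℝ × ℝ) : Set (ℝ × ℝ) :=
  {Q | Q ≠ P ∧ D.Precedes Q P ∧ Q.2 = P.2 ∧ segment ℝ Q P ⊆ D.curve}

/-- `L_t(P)`: the maximal segment of `γ`, parallel to the `t`-axis, that consists of points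
subsequent to `P` and issues from `P`; the point `P` itself is excluded. -/
def Lt (P : ℝ × ℝ) : Set (ℝ × ℝ) :=
  {Q | Q ≠ P ∧ D.Precedes P Q ∧ Q.1 = P.1 ∧ segment ℝ P Q ⊆ D.curve}

/-- `S(P)`: the vertices, other than `P`, that precede `P` and lie on a segment of `γ` through `P`
that is parallel to the `s`-axis. -/
def S (P : ℝ × ℝ) : Set (ℝ × ℝ) := {Q | Q ∈ range D.vertex ∧ Q ∈ D.Ls P}

/-- `T(P)`: the vertices, other than `P`, that are subsequent to `P` and lie on a segment of `γ`
through `P` that is parallel to the `t`-axis. -/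
def T (P : ℝ × ℝ) : Set (ℝ × ℝ) := {Q | Q ∈ range D.vertex ∧ Q ∈ D.Lt P}

end CurvedDomain

/-- The arguments `(s, t, x, p, q, u)` of `f` and `Φ`; `p`, `q` are the slots of `x_s`, `x_t`. -/
abbrev Arg (n m : ℕ) : Type :=
  ℝ × ℝ × (Fin n → ℝ) × (Fin n → ℝ) × (Fin n → ℝ) × (Fin m → ℝ)

/-- The arguments `(s, t, x, η)` of `Φ₁`; `η` is the slot of `x_μ`. -/
abbrev Arg₁ (n : ℕ) : Type := ℝ × ℝ × (Fin n → ℝ) × (Fin n → ℝ)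

/-- The data of the control problem: the right-hand side `f` of the state equation
`x_st = f(s, t, x, x_s, x_t, u)`, and the integrands of the cost functional
`∬_G Φ(s, t, x, x_s, x_t, u) dA + ∫_γ Φ₁(s, t, x, x_μ) dμ + ∑_r Φ₀(P_r, x(P_r))`. -/
structure ControlProblem (n m : ℕ) where
  f : Arg n m → Fin n → ℝ
  Φ : Arg n m → ℝ
  Φ₁ : Arg₁ n → ℝ
  Φ₀ : ℝ × ℝ → (Fin n → ℝ) → ℝ
  contDiff_f : ContDiff ℝ 1 f
  contDiff_Φ : ContDiff ℝ 2 Φ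
  contDiff_Φ₁ : ContDiff ℝ 2 Φ₁
  contDiff_Φ₀ : ∀ P, ContDiff ℝ 1 (Φ₀ P)

/-- The arguments `(s, t, x(s,t), x_s(s,t), x_t(s,t), u(s,t))` along a state `x` and a
control `u`. -/
def along {n m : ℕ} (x : ℝ × ℝ → Fin n → ℝ) (u : ℝ × ℝ → Fin m → ℝ) (P : ℝ × ℝ) : Arg n m :=
  (P.1, P.2, x P, partialS x P, partialT x P, u P)

namespace ControlProblem

variable {n m N : ℕ} (pb : ControlProblem n m)

/-- `∂f^i/∂x^k`. -/
def fx (z : Arg n m) (i k : Fin n) : ℝ := fderiv ℝ pb.f z (0, 0, Pi.single k 1, 0, 0, 0) i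

/-- `∂f^i/∂p^k`. -/
def fp (z : Arg n m) (i k : Fin n) : ℝ := fderiv ℝ pb.f z (0, 0, 0, Pi.single k 1, 0, 0) i

/-- `∂f^i/∂q^k`. -/
def fq (z : Arg n m) (i k : Fin n) : ℝ := fderiv ℝ pb.f z (0, 0, 0, 0, Pi.single k 1, 0) i

/-- `∂Φ/∂x^i`. -/
def Φx (i : Fin n) (z : Arg n m) : ℝ := fderiv ℝ pb.Φ z (0, 0, Pi.single i 1, 0, 0, 0)

/-- `∂Φ/∂p^i`. -/
def Φp (i : Fin n) (z : Arg n m) : ℝ := fderiv ℝ pb.Φ z (0, 0, 0, Pi.single i 1, 0, 0)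

/-- `∂Φ/∂q^i`. -/
def Φq (i : Fin n) (z : Arg n m) : ℝ := fderiv ℝ pb.Φ z (0, 0, 0, 0, Pi.single i 1, 0)

/-- `∂Φ₁/∂x^i`. -/
def Φ₁x (i : Fin n) (z : Arg₁ n) : ℝ := fderiv ℝ pb.Φ₁ z (0, 0, Pi.single i 1, 0)

/-- `∂Φ₁/∂η^i`. -/
def Φ₁η (i : Fin n) (z : Arg₁ n) : ℝ := fderiv ℝ pb.Φ₁ z (0, 0, 0, Pi.single i 1)

/-- `∂Φ₀/∂x^i`. -/
def Φ₀x (i : Fin n) (P : ℝ × ℝ) (y : Fin n → ℝ) : ℝ := fderiv ℝ (pb.Φ₀ P) y (Pi.single i 1)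

/-- `x` is a state trajectory for the control `u`: `x` is `C²` and `u` is `C¹` up to the boundary
of `G`, and `x` solves the Goursat-Darboux equation (with data `x(s, 0)`, `x(0, t)` on the axes). -/
structure IsTrajectory (D : CurvedDomain N) (x : ℝ × ℝ → Fin n → ℝ)
    (u : ℝ × ℝ → Fin m → ℝ) : Prop where
  contDiffAt_x : ∀ P ∈ D.G, ContDiffAt ℝ 2 x P
  contDiffAt_u : ∀ P ∈ D.G, ContDiffAt ℝ 1 u P
  state_eq : ∀ P ∈ interior D.G ∪ D.curve, partialS (partialT x) P = pb.f (along x u P)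

/-- `R P Q i j = R^i_j(P, Q)`, for `P ∈ G` and `Q ∈ W(P)`, is the matrix-valued Riemann function of
the linearized state equation along `(x, u)`: as a function of `P = (s, t)` it solves, for every
`Q = (σ, τ)`,
`R_st = f_x R + f_p R_s + f_q R_t`, `R_s = f_q R` for `t = τ`, `R_t = f_p R` for `s = σ`, and
`R(Q, Q) = 1`.  Here `Rs`, `Rt` are the partial derivatives of `R` with respect to `s`, `t`; as usual,
`R`, `R_s`, `R_t` are continuous. -/
def IsRiemannMatrix (D : CurvedDomain N) (x : ℝ × ℝ → Fin n → ℝ) (u : ℝ × ℝ → Fin m → ℝ)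
    (R : ℝ × ℝ → ℝ × ℝ → Matrix (Fin n) (Fin n) ℝ) : Prop :=
  ∃ Rs Rt : ℝ × ℝ → ℝ × ℝ → Matrix (Fin n) (Fin n) ℝ,
    (∀ i j,
      ContinuousOn (fun z : (ℝ × ℝ) × (ℝ × ℝ) => R z.1 z.2 i j) {z | z.1 ∈ D.G ∧ z.2 ∈ rect z.1} ∧
      ContinuousOn (fun z : (ℝ × ℝ) × (ℝ × ℝ) => Rs z.1 z.2 i j) {z | z.1 ∈ D.G ∧ z.2 ∈ rect z.1} ∧
      ContinuousOn (fun z : (ℝ × ℝ) × (ℝ × ℝ) => Rt z.1 z.2 i j)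
        {z | z.1 ∈ D.G ∧ z.2 ∈ rect z.1}) ∧
    ∀ s t σ τ, (s, t) ∈ D.G → (σ, τ) ∈ rect (s, t) → ∀ i j,
      HasDerivWithinAt (fun s' => R (s', t) (σ, τ) i j) (Rs (s, t) (σ, τ) i j)
        {s' | σ ≤ s' ∧ (s', t) ∈ D.G} s ∧
      HasDerivWithinAt (fun t' => R (s, t') (σ, τ) i j) (Rt (s, t) (σ, τ) i j)
        {t' | τ ≤ t' ∧ (s, t') ∈ D.G} t ∧
      HasDerivWithinAt (fun t' => Rs (s, t') (σ, τ) i j)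
        (∑ k, (pb.fx (along x u (s, t)) i k * R (s, t) (σ, τ) k j
          + pb.fp (along x u (s, t)) i k * Rs (s, t) (σ, τ) k j
          + pb.fq (along x u (s, t)) i k * Rt (s, t) (σ, τ) k j))
        {t' | τ ≤ t' ∧ (s, t') ∈ D.G} t ∧
      (t = τ → Rs (s, t) (σ, τ) i j =
        ∑ k, pb.fq (along x u (s, t)) i k * R (s, t) (σ, τ) k j) ∧
      (s = σ → Rt (s, t) (σ, τ) i j =
        ∑ k, pb.fp (along x u (s, t)) i k * R (s, t) (σ, τ) k j) ∧
      (s = σ → t = τ → R (s, t) (σ, τ) i j = if i = j then 1 else 0)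

/-- `F_i = Φ_{x^i} - (D/Ds) Φ_{p^i} - (D/Dt) Φ_{q^i}` along `(x, u)`, where `D/Ds`, `D/Dt` are total
derivatives. -/
def F (x : ℝ × ℝ → Fin n → ℝ) (u : ℝ × ℝ → Fin m → ℝ) (i : Fin n) (P : ℝ × ℝ) : ℝ :=
  pb.Φx i (along x u P) - partialS (fun Q => pb.Φp i (along x u Q)) P
    - partialT (fun Q => pb.Φq i (along x u Q)) P

/-- The arguments `(s, t, x, x_μ)` at the point of `γ` with arc-length parameter `μ`, where
`x_μ = -n₂ x_s + n₁ x_t` is the tangential derivative. -/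
def _root_.GoursatDarboux.alongCurve (D : CurvedDomain N) (x : ℝ × ℝ → Fin n → ℝ) (μ : ℝ) :
    Arg₁ n :=
  (D.L₁ μ, D.L₂ μ, x (D.point μ),
    (-D.n₂ μ) • partialS x (D.point μ) + D.n₁ μ • partialT x (D.point μ))

/-- `F_{1,i} = n₁ Φ_{p^i} + n₂ Φ_{q^i} + Φ_{1,x^i} - (D/Dμ) Φ_{1,η^i}`, at the point of `γ` with
arc-length parameter `μ`. -/
def F₁ (D : CurvedDomain N) (x : ℝ × ℝ → Fin n → ℝ) (u : ℝ × ℝ → Fin m → ℝ) (i : Fin n) (μ : ℝ) :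
    ℝ :=
  D.n₁ μ * pb.Φp i (along x u (D.point μ)) + D.n₂ μ * pb.Φq i (along x u (D.point μ))
    + pb.Φ₁x i (alongCurve D x μ) - deriv (fun ν => pb.Φ₁η i (alongCurve D x ν)) μ

/-- `F_{0,i}(P_r) = Φ_{0,x^i}(P_r, x(P_r)) - V_r(Φ_{1,η^i})`, where `V_r(φ)` is the limit of `φ` at
`P_r` from the side of larger arc length minus its limit from the side of smaller arc length. -/
def F₀ (D : CurvedDomain N) (x : ℝ × ℝ → Fin n → ℝ) (i : Fin n) (r : Fin (N + 2)) : ℝ :=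
  pb.Φ₀x i (D.vertex r) (x (D.vertex r)) -
    (Function.rightLim (fun ν => pb.Φ₁η i (alongCurve D x ν)) (D.mark r) -
      Function.leftLim (fun ν => pb.Φ₁η i (alongCurve D x ν)) (D.mark r))

open Classical in
/-- The co-state `ψ_j(P)`; the last sum runs over the vertices `P_1, ..., P_N`. -/
def costate (D : CurvedDomain N) (x : ℝ × ℝ → Fin n → ℝ) (u : ℝ × ℝ → Fin m → ℝ)
    (R : ℝ × ℝ → ℝ × ℝ → Matrix (Fin n) (Fin n) ℝ) (j : Fin n) (P : ℝ × ℝ) : ℝ :=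
  (∫ Q in D.E P, ∑ i, pb.F x u i Q * R Q P i j)
    + (∫ μ in D.params (D.arc P), ∑ i, pb.F₁ D x u i μ * R (D.point μ) P i j)
    + ∑ r : Fin N, ∑ i,
        pb.F₀ D x i r.succ.castSucc * R (D.vertex r.succ.castSucc) P i j *
          (if P ∈ rect (D.vertex r.succ.castSucc) then 1 else 0)

end ControlProblem

/-- The jump of `φ` at `P` across the line through `P` parallel to the `s`-axis exists and
equals `c`: it is the limit from below (smaller `t`) minus the limit from above. -/
def HasJumpS (φ : ℝ × ℝ → ℝ) (P : ℝ × ℝ) (c : ℝ) : Prop :=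
  ∃ lminus lplus : ℝ, Tendsto (fun τ => φ (P.1, τ)) (𝓝[<] P.2) (𝓝 lminus) ∧
    Tendsto (fun τ => φ (P.1, τ)) (𝓝[>] P.2) (𝓝 lplus) ∧ c = lminus - lplus

/-- The jump of `φ` at `P` across the line through `P` parallel to the `t`-axis exists and
equals `c`: it is the limit from the left (smaller `s`) minus the limit from the right. -/
def HasJumpT (φ : ℝ × ℝ → ℝ) (P : ℝ × ℝ) (c : ℝ) : Prop :=
  ∃ lminus lplus : ℝ, Tendsto (fun σ => φ (σ, P.2)) (𝓝[<] P.1) (𝓝 lminus) ∧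
    Tendsto (fun σ => φ (σ, P.2)) (𝓝[>] P.1) (𝓝 lplus) ∧ c = lminus - lplus

end GoursatDarboux

end

namespace GoursatDarboux

/-! The co-state is a sum of three integrals of the same shape: with $(A,\nu)$ a compact set and a
measure, and $y\mapsto pt(y)\in G$ continuous, each one is $Q\mapsto\int_{\{y\in A:\,Q\in
W(pt(y))\}}\sum_i g_i(y)R^i_j(pt(y),Q)\,d\nu(y)$. Here $A$ is $G$ with area, the parameter interval
of the curve with arc length, or the set of inner vertices with counting measure.

Let $Q$ tend to $P$ vertically. From below, the domain of integration tends pointwise to $\{P\in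
W(pt(y))\}$, since the rectangles are closed. From above, it tends to the part of that set with
$t(P)<t(pt(y))$. The kernel is continuous on a compact set, hence bounded, and dominated convergence
gives both limits (`tendsto_integral_sum_mul_kernel`). Their difference is the integral over
$\{t(pt(y))=t(P)\}$ (`hasJumpS_integral`; `hasJumpT_integral` for the other direction).

It remains to identify this set. For area it is null. On the curve it is $L_s(P_q)$ up to the single
point $P_q$ (`params_Ls_ae_eq`), and among the vertices it is $S(P_q)\cup\{P_q\}$
(`vertex_mem_S_union_iff`). The integrability of $F_1$ comes from its continuous extension to each
closed arc (`exists_continuousOn_eqOn_F₁`). -/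

theorem contDiffAt_partialS {E : Type*} [NormedAddCommGroup E] [NormedSpace ℝ E]
    {φ : ℝ × ℝ → E} {P : ℝ × ℝ} {k l : WithTop ℕ∞} (h : ContDiffAt ℝ l φ P) (hkl : k + 1 ≤ l) :
    ContDiffAt ℝ k (partialS φ) P :=
  (h.fderiv_right hkl).clm_apply contDiffAt_const

theorem contDiffAt_partialT {E : Type*} [NormedAddCommGroup E] [NormedSpace ℝ E]
    {φ : ℝ × ℝ → E} {P : ℝ × ℝ} {k l : WithTop ℕ∞} (h : ContDiffAt ℝ l φ P) (hkl : k + 1 ≤ l) :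
    ContDiffAt ℝ k (partialT φ) P :=
  (h.fderiv_right hkl).clm_apply contDiffAt_const

theorem contDiffAt_along {n m : ℕ} {x : ℝ × ℝ → Fin n → ℝ} {u : ℝ × ℝ → Fin m → ℝ} {P : ℝ × ℝ}
    (hx : ContDiffAt ℝ 2 x P) (hu : ContDiffAt ℝ 1 u P) : ContDiffAt ℝ 1 (along x u) P :=
  contDiffAt_fst.prodMk <| contDiffAt_snd.prodMk <| (hx.of_le (by norm_num)).prodMk <|
    (contDiffAt_partialS hx (by norm_num)).prodMk <|
      (contDiffAt_partialT hx (by norm_num)).prodMk hu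

theorem isClosed_setOf_mem_rect : IsClosed {z : (ℝ × ℝ) × (ℝ × ℝ) | z.2 ∈ rect z.1} := by
  simp only [rect, ofPred_and]
  refine (isClosed_le ?_ ?_).inter ((isClosed_le ?_ ?_).inter
    ((isClosed_le ?_ ?_).inter (isClosed_le ?_ ?_))) <;> fun_prop

theorem isClosed_setOf_mem_rect_left (P : ℝ × ℝ) : IsClosed {Q | P ∈ rect Q} :=
  isClosed_setOf_mem_rect.preimage (by fun_prop : Continuous fun Q : ℝ × ℝ => (Q, P))

/-! ### Geometry of the curve and of the region $G$. -/

namespace CurvedDomain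

variable {N : ℕ} (D : CurvedDomain N)

theorem exists_mem_arc {μ : ℝ} (h0 : 0 ≤ μ) (hlen : μ < D.len) :
    ∃ r : Fin (N + 1), μ ∈ Ico (D.mark r.castSucc) (D.mark r.succ) := by
  by_contra! h
  have key : ∀ k : Fin (N + 2), D.mark k ≤ μ := by
    intro k
    induction k using Fin.induction with
    | zero => rw [D.mark_zero]; exact h0
    | succ r ih => by_contra! hr; exact h r ⟨ih, hr⟩
  have := key (Fin.last (N + 1))
  rw [D.mark_last] at this
  exact this.not_gt hlen

theorem mark_mem (k : Fin (N + 2)) : D.mark k ∈ Icc 0 D.len :=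
  ⟨D.mark_zero ▸ D.mark_strictMono.monotone (Fin.zero_le k),
    D.mark_last ▸ D.mark_strictMono.monotone (Fin.le_last k)⟩

theorem mark_lt (r : Fin (N + 1)) : D.mark r.castSucc < D.mark r.succ :=
  D.mark_strictMono r.castSucc_lt_succ

theorem len_pos : 0 < D.len := by
  rw [← D.mark_zero, ← D.mark_last]
  exact D.mark_strictMono (Fin.last_pos)

theorem arc_subset (r : Fin (N + 1)) :
    Icc (D.mark r.castSucc) (D.mark r.succ) ⊆ Icc 0 D.len :=
  Icc_subset_Icc (D.mark_mem _).1 (D.mark_mem _).2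

theorem iUnion_arc :
    ⋃ r : Fin (N + 1), Icc (D.mark r.castSucc) (D.mark r.succ) = Icc 0 D.len := by
  refine (iUnion_subset D.arc_subset).antisymm fun μ hμ => mem_iUnion.2 ?_
  rcases hμ.2.lt_or_eq with h | h
  · obtain ⟨r, hr⟩ := D.exists_mem_arc hμ.1 h
    exact ⟨r, Ico_subset_Icc_self hr⟩
  · refine ⟨Fin.last N, ?_⟩
    have : D.mark (Fin.last N).succ = D.len := by rw [Fin.succ_last, D.mark_last]
    rw [h, ← this]
    exact right_mem_Icc.2 (D.mark_lt _).le

theorem continuousOn_point : ContinuousOn D.point (Icc 0 D.len) := by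
  rw [← D.iUnion_arc]
  exact (locallyFinite_of_finite _).continuousOn_iUnion (fun _ => isClosed_Icc) fun r =>
    (D.contDiff r).1.continuousOn.prodMk (D.contDiff r).2.continuousOn

theorem continuousOn_L₁ : ContinuousOn D.L₁ (Icc 0 D.len) :=
  continuous_fst.comp_continuousOn D.continuousOn_point

theorem continuousOn_L₂ : ContinuousOn D.L₂ (Icc 0 D.len) :=
  continuous_snd.comp_continuousOn D.continuousOn_point

/-- If two parameters gave the same point, monotonicity would freeze both coordinates between them,
contradicting unit speed. -/
theorem point_injOn : InjOn D.point (Icc 0 D.len) := by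
  have key : ∀ μ ∈ Icc 0 D.len, ∀ ν ∈ Icc 0 D.len, μ < ν → D.point μ ≠ D.point ν := by
    intro μ hμ ν hν hlt heq
    obtain ⟨r, hr⟩ := D.exists_mem_arc hμ.1 (hlt.trans_le hν.2)
    -- Unit speed is known only inside the arcs, so `ξ` is taken before the next vertex as well as
    -- before `ν`.
    obtain ⟨ξ, hξ⟩ := exists_between (lt_min hlt hr.2)
    have hξ2 := lt_min_iff.1 hξ.2
    have hsub : Icc μ ν ⊆ Icc 0 D.len := Icc_subset_Icc hμ.1 hν.2
    have hev : ∀ᶠ y in 𝓝 ξ, y ∈ Icc μ ν := Icc_mem_nhds hξ.1 hξ2.1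
    have h1 : D.L₁ μ = D.L₁ ν := congrArg Prod.fst heq
    have h2 : D.L₂ μ = D.L₂ ν := congrArg Prod.snd heq
    have d1 : deriv D.L₁ ξ = 0 := by
      have : D.L₁ =ᶠ[𝓝 ξ] fun _ => D.L₁ μ := by
        filter_upwards [hev] with y hy
        exact (D.antitone_L₁ hμ (hsub hy) hy.1).antisymm
          (h1.trans_le (D.antitone_L₁ (hsub hy) hν hy.2))
      rw [this.deriv_eq, deriv_const]
    have d2 : deriv D.L₂ ξ = 0 := by
      have : D.L₂ =ᶠ[𝓝 ξ] fun _ => D.L₂ μ := by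
        filter_upwards [hev] with y hy
        exact ((D.monotone_L₂ (hsub hy) hν hy.2).trans_eq h2.symm).antisymm
          (D.monotone_L₂ hμ (hsub hy) hy.1)
      rw [this.deriv_eq, deriv_const]
    have := D.unit_speed r ξ ⟨hr.1.trans_lt hξ.1, hξ2.2⟩
    simp [d1, d2] at this
  intro μ hμ ν hν h
  rcases lt_trichotomy μ ν with hlt | heq | hlt
  · exact absurd h (key μ hμ ν hν hlt)
  · exact heq
  · exact absurd h.symm (key ν hν μ hμ hlt)

theorem point_nonneg {μ : ℝ} (hμ : μ ∈ Icc 0 D.len) : 0 ≤ D.L₁ μ ∧ 0 ≤ D.L₂ μ :=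
  ⟨D.end_eq.1 ▸ D.antitone_L₁ hμ (right_mem_Icc.2 D.len_pos.le) hμ.2,
    D.start_eq.2 ▸ D.monotone_L₂ (left_mem_Icc.2 D.len_pos.le) hμ hμ.1⟩

theorem point_le {μ : ℝ} (hμ : μ ∈ Icc 0 D.len) : D.L₁ μ ≤ D.a ∧ D.L₂ μ ≤ D.b :=
  ⟨D.start_eq.1 ▸ D.antitone_L₁ (left_mem_Icc.2 D.len_pos.le) hμ hμ.1,
    D.end_eq.2 ▸ D.monotone_L₂ hμ (right_mem_Icc.2 D.len_pos.le) hμ.2⟩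

theorem mem_G_iff {P : ℝ × ℝ} : P ∈ D.G ↔ ∃ μ ∈ Icc 0 D.len, P ∈ rect (D.point μ) := by
  simp [G, curve]

theorem point_mem_G {μ : ℝ} (hμ : μ ∈ Icc 0 D.len) : D.point μ ∈ D.G :=
  D.mem_G_iff.2 ⟨μ, hμ, (D.point_nonneg hμ).1, le_rfl, (D.point_nonneg hμ).2, le_rfl⟩

theorem isCompact_curve : IsCompact D.curve :=
  isCompact_Icc.image_of_continuousOn D.continuousOn_point

/-- $G$ is the projection of a closed subset of a compact product: the pairs of a curve point and a
point of its rectangle. -/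
theorem isCompact_G : IsCompact D.G := by
  have h : D.G = Prod.snd '' ((D.curve ×ˢ Icc ((0 : ℝ), (0 : ℝ)) (D.a, D.b)) ∩
      {z : (ℝ × ℝ) × (ℝ × ℝ) | z.2 ∈ rect z.1}) := by
    ext P
    constructor
    · intro hP
      obtain ⟨μ, hμ, h⟩ := D.mem_G_iff.1 hP
      exact ⟨(D.point μ, P), ⟨⟨mem_image_of_mem _ hμ, ⟨h.1, h.2.2.1⟩,
        ⟨h.2.1.trans (D.point_le hμ).1, h.2.2.2.trans (D.point_le hμ).2⟩⟩, h⟩, rfl⟩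
    · rintro ⟨z, ⟨hz, hz'⟩, rfl⟩
      exact ⟨z.1, hz.1, hz'⟩
  rw [h]
  exact ((D.isCompact_curve.prod isCompact_Icc).inter_right isClosed_setOf_mem_rect).image
    continuous_snd

theorem rect_subset_G {Q : ℝ × ℝ} (hQ : Q ∈ D.G) : rect Q ⊆ D.G := by
  obtain ⟨T, hT, h⟩ := hQ
  exact fun P hP => ⟨T, hT, hP.1, hP.2.1.trans h.2.1, hP.2.2.1, hP.2.2.2.trans h.2.2.2⟩

/-- This is the domain of the Riemann matrix; its compactness provides the uniform bound for
dominated convergence. -/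
theorem isCompact_setOf_mem_rect :
    IsCompact {z : (ℝ × ℝ) × (ℝ × ℝ) | z.1 ∈ D.G ∧ z.2 ∈ rect z.1} := by
  have : {z : (ℝ × ℝ) × (ℝ × ℝ) | z.1 ∈ D.G ∧ z.2 ∈ rect z.1} =
      (D.G ×ˢ D.G) ∩ {z | z.2 ∈ rect z.1} := by
    ext z
    exact ⟨fun h => ⟨⟨h.1, D.rect_subset_G h.1 h.2⟩, h.2⟩, fun h => ⟨h.1.1, h.2⟩⟩
  rw [this]
  exact (D.isCompact_G.prod D.isCompact_G).inter_right isClosed_setOf_mem_rect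

/-- An interior point of `G` lies strictly below and to the left of some point of the curve, and
strictly inside the first quadrant. -/
theorem exists_point_gt {P : ℝ × ℝ} (hP : P ∈ interior D.G) :
    0 < P.1 ∧ 0 < P.2 ∧ ∃ ν ∈ Icc 0 D.len, P.1 < D.L₁ ν ∧ P.2 < D.L₂ ν := by
  obtain ⟨ε, hε, hball⟩ := Metric.isOpen_iff.1 isOpen_interior P hP
  -- Moving diagonally by `ε / 2` makes both upper inequalities strict; moving by `-(ε / 2)` gives
  -- positivity.
  have hmem : ∀ c : ℝ, |c| < ε → (P.1 + c, P.2 + c) ∈ D.G := fun c hc => by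
    refine interior_subset (hball ?_)
    rw [Metric.mem_ball, Prod.dist_eq, Real.dist_eq, Real.dist_eq]
    simpa using hc
  have hpos : |ε / 2| < ε := by rw [abs_of_pos (by linarith)]; linarith
  obtain ⟨ν, hν, h⟩ := D.mem_G_iff.1 (hmem (ε / 2) hpos)
  obtain ⟨ν', -, h'⟩ := D.mem_G_iff.1 (hmem (-(ε / 2)) (by rwa [abs_neg]))
  have e1 := h.2.1
  have e2 := h.2.2.2
  have e3 := h'.1
  have e4 := h'.2.2.1
  simp only [point] at e1 e2 e3 e4
  exact ⟨by linarith, by linarith, ν, hν, by linarith, by linarith⟩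

/-- Some curve point `ν` dominates `P` strictly in both coordinates. It is higher than `μ`, hence
comes later, hence lies weakly to the left of `μ`. So a curve point level with `P` automatically has
`P` in its rectangle. -/
theorem lt_L₁_of_L₂_eq {P : ℝ × ℝ} (hP : P ∈ interior D.G) {μ : ℝ} (hμ : μ ∈ Icc 0 D.len)
    (h : D.L₂ μ = P.2) : P.1 < D.L₁ μ := by
  obtain ⟨-, -, ν, hν, h1, h2⟩ := D.exists_point_gt hP
  have : μ < ν := by
    by_contra! hle
    exact absurd (D.monotone_L₂ hν hμ hle) (by rw [h]; exact h2.not_ge)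
  exact h1.trans_le (D.antitone_L₁ hμ hν this.le)

theorem lt_L₂_of_L₁_eq {P : ℝ × ℝ} (hP : P ∈ interior D.G) {μ : ℝ} (hμ : μ ∈ Icc 0 D.len)
    (h : D.L₁ μ = P.1) : P.2 < D.L₂ μ := by
  obtain ⟨-, -, ν, hν, h1, h2⟩ := D.exists_point_gt hP
  have : ν < μ := by
    by_contra! hle
    exact absurd (D.antitone_L₁ hμ hν hle) (by rw [h]; exact h1.not_ge)
  exact h2.trans_le (D.monotone_L₂ hν hμ this.le)

/-- The last vertex on a horizontal line is the last point of the curve on that line. -/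
theorem le_mark_of_L₂_eq {r q : Fin (N + 2)}
    (hq : IsGreatest {k | (D.vertex k).2 = (D.vertex r).2} q) {μ : ℝ} (hμ : μ ∈ Icc 0 D.len)
    (h : D.L₂ μ = D.L₂ (D.mark q)) : μ ≤ D.mark q := by
  by_contra! hlt
  induction q using Fin.lastCases with
  | last => rw [D.mark_last] at hlt; exact hμ.2.not_gt hlt
  | cast q =>
    have hI := D.mark_lt q
    have hsub := D.arc_subset q
    -- Truncating at the next vertex keeps the comparison within the single arc that starts at `q`.
    set ν := min μ (D.mark q.succ) with hν
    have hqν : D.mark q.castSucc < ν := lt_min hlt hI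
    have hνI : ν ∈ Icc (D.mark q.castSucc) (D.mark q.succ) := ⟨hqν.le, min_le_right _ _⟩
    have h2 : D.L₂ ν = D.L₂ (D.mark q.castSucc) :=
      ((D.monotone_L₂ (hsub hνI) hμ (min_le_left _ _)).trans_eq h).antisymm
        (D.monotone_L₂ (D.mark_mem _) (hsub hνI) hqν.le)
    -- The height is constant up to `ν`: a vertical arc would contradict injectivity, a horizontal
    -- one would put a later vertex on the line, an oblique one has strictly increasing height.
    rcases D.flat_or_oblique q with hv | hh | ho
    · exact hqν.ne' (D.point_injOn (hsub hνI) (D.mark_mem _) (Prod.ext (hv ν hνI) h2))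
    · have := hq.2 (show q.succ ∈ {k | (D.vertex k).2 = (D.vertex r).2} from
        (hh _ (right_mem_Icc.2 hI.le)).trans hq.1)
      exact this.not_gt q.castSucc_lt_succ
    · exact (ho.2 (left_mem_Icc.2 hI.le) hνI hqν).ne' h2

/-- The first vertex on a vertical line is the first point of the curve on that line. -/
theorem mark_le_of_L₁_eq {r q : Fin (N + 2)}
    (hq : IsLeast {k | (D.vertex k).1 = (D.vertex r).1} q) {μ : ℝ} (hμ : μ ∈ Icc 0 D.len)
    (h : D.L₁ μ = D.L₁ (D.mark q)) : D.mark q ≤ μ := by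
  by_contra! hlt
  induction q using Fin.cases with
  | zero => rw [D.mark_zero] at hlt; exact hμ.1.not_gt hlt
  | succ q =>
    have hI := D.mark_lt q
    have hsub := D.arc_subset q
    -- The mirror image: the comparison takes place on the arc that ends at the vertex, and
    -- horizontal and vertical arcs exchange roles.
    set ν := max μ (D.mark q.castSucc) with hν
    have hqν : ν < D.mark q.succ := max_lt hlt hI
    have hνI : ν ∈ Icc (D.mark q.castSucc) (D.mark q.succ) := ⟨le_max_right _ _, hqν.le⟩
    have hr := right_mem_Icc.2 hI.le
    have h1 : D.L₁ ν = D.L₁ (D.mark q.succ) :=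
      ((D.antitone_L₁ hμ (hsub hνI) (le_max_left _ _)).trans_eq h).antisymm
        (D.antitone_L₁ (hsub hνI) (D.mark_mem _) hqν.le)
    rcases D.flat_or_oblique q with hv | hh | ho
    · have := hq.2 (show q.castSucc ∈ {k | (D.vertex k).1 = (D.vertex r).1} from
        (hv _ hr).symm.trans hq.1)
      exact this.not_gt q.castSucc_lt_succ
    · exact hqν.ne (D.point_injOn (hsub hνI) (D.mark_mem _)
        (Prod.ext h1 ((hh ν hνI).trans (hh _ hr).symm)))
    · exact (ho.1 hνI hr hqν).ne' h1

/-- Between the two parameters the height is constant by monotonicity, and the abscissa takes all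
intermediate values. -/
theorem segment_subset_curve_of_L₂_eq {μ ν : ℝ} (hμ : μ ∈ Icc 0 D.len) (hν : ν ∈ Icc 0 D.len)
    (hle : μ ≤ ν) (h : D.L₂ μ = D.L₂ ν) : segment ℝ (D.point μ) (D.point ν) ⊆ D.curve := by
  have hsub : Icc μ ν ⊆ Icc 0 D.len := Icc_subset_Icc hμ.1 hν.2
  rintro Q ⟨α, β, hα, hβ, hαβ, rfl⟩
  have h1 := D.antitone_L₁ hμ hν hle
  have hm : α * D.L₁ μ + β * D.L₁ ν ∈ Icc (D.L₁ ν) (D.L₁ μ) := by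
    obtain rfl : α = 1 - β := by linarith
    constructor <;> nlinarith
  obtain ⟨ξ, hξ, hξe⟩ := intermediate_value_Icc' hle (D.continuousOn_L₁.mono hsub) hm
  refine ⟨ξ, hsub hξ, Prod.ext hξe ?_⟩
  have e : D.L₂ ξ = D.L₂ ν := (D.monotone_L₂ (hsub hξ) hν hξ.2).antisymm
    (h.symm.trans_le (D.monotone_L₂ hμ (hsub hξ) hξ.1))
  simp only [point, Prod.snd_add, Prod.smul_snd, smul_eq_mul, e, h, ← add_mul, hαβ, one_mul]

theorem segment_subset_curve_of_L₁_eq {μ ν : ℝ} (hμ : μ ∈ Icc 0 D.len) (hν : ν ∈ Icc 0 D.len)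
    (hle : μ ≤ ν) (h : D.L₁ μ = D.L₁ ν) : segment ℝ (D.point μ) (D.point ν) ⊆ D.curve := by
  have hsub : Icc μ ν ⊆ Icc 0 D.len := Icc_subset_Icc hμ.1 hν.2
  rintro Q ⟨α, β, hα, hβ, hαβ, rfl⟩
  have h1 := D.monotone_L₂ hμ hν hle
  have hm : α * D.L₂ μ + β * D.L₂ ν ∈ Icc (D.L₂ μ) (D.L₂ ν) := by
    obtain rfl : α = 1 - β := by linarith
    constructor <;> nlinarith
  obtain ⟨ξ, hξ, hξe⟩ := intermediate_value_Icc hle (D.continuousOn_L₂.mono hsub) hm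
  refine ⟨ξ, hsub hξ, Prod.ext ?_ hξe⟩
  have e : D.L₁ ξ = D.L₁ ν := ((D.antitone_L₁ hμ (hsub hξ) hξ.1).trans_eq h).antisymm
    (D.antitone_L₁ (hsub hξ) hν hξ.2)
  simp only [point, Prod.fst_add, Prod.smul_fst, smul_eq_mul, e, h, ← add_mul, hαβ, one_mul]

/-- The curve meets the horizontal line in a single segment, whose last point is $P_q$. The order
and segment conditions in `Ls` thus reduce to one equation for the height. -/
theorem point_mem_Ls_iff {r q : Fin (N + 2)}
    (hq : IsGreatest {k | (D.vertex k).2 = (D.vertex r).2} q) {μ : ℝ} (hμ : μ ∈ Icc 0 D.len) :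
    D.point μ ∈ D.Ls (D.vertex q) ↔ μ ≠ D.mark q ∧ D.L₂ μ = (D.vertex r).2 := by
  have hqr : D.L₂ (D.mark q) = (D.vertex r).2 := hq.1
  constructor
  · rintro ⟨hne, -, h, -⟩
    exact ⟨fun e => hne (congrArg D.point e), h.trans hqr⟩
  · rintro ⟨hne, h⟩
    rw [← hqr] at h
    have hle := D.le_mark_of_L₂_eq hq hμ h
    exact ⟨fun e => hne (D.point_injOn hμ (D.mark_mem q) e),
      ⟨μ, hμ, D.mark q, D.mark_mem q, hle.lt_of_ne hne, rfl, rfl⟩, h,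
      D.segment_subset_curve_of_L₂_eq hμ (D.mark_mem q) hle h⟩

theorem point_mem_Lt_iff {r q : Fin (N + 2)}
    (hq : IsLeast {k | (D.vertex k).1 = (D.vertex r).1} q) {μ : ℝ} (hμ : μ ∈ Icc 0 D.len) :
    D.point μ ∈ D.Lt (D.vertex q) ↔ μ ≠ D.mark q ∧ D.L₁ μ = (D.vertex r).1 := by
  have hqr : D.L₁ (D.mark q) = (D.vertex r).1 := hq.1
  constructor
  · rintro ⟨hne, -, h, -⟩
    exact ⟨fun e => hne (congrArg D.point e), h.trans hqr⟩
  · rintro ⟨hne, h⟩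
    rw [← hqr] at h
    have hle := D.mark_le_of_L₁_eq hq hμ h
    exact ⟨fun e => hne (D.point_injOn hμ (D.mark_mem q) e),
      ⟨D.mark q, D.mark_mem q, μ, hμ, hle.lt_of_ne' hne, rfl, rfl⟩, h,
      D.segment_subset_curve_of_L₁_eq (D.mark_mem q) hμ hle h.symm⟩

theorem vertex_mem_S_union_iff {r q : Fin (N + 2)}
    (hq : IsGreatest {k | (D.vertex k).2 = (D.vertex r).2} q) (k : Fin (N + 2)) :
    D.vertex k ∈ D.S (D.vertex q) ∪ {D.vertex q} ↔ (D.vertex k).2 = (D.vertex r).2 := by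
  constructor
  · rintro (h | h)
    · exact ((D.point_mem_Ls_iff hq (D.mark_mem k)).1 h.2).2
    · rw [mem_singleton_iff.1 h]; exact hq.1
  · intro h
    by_cases hk : k = q
    · exact Or.inr (by rw [hk]; rfl)
    · exact Or.inl ⟨mem_range_self k, (D.point_mem_Ls_iff hq (D.mark_mem k)).2
        ⟨D.mark_strictMono.injective.ne hk, h⟩⟩

theorem vertex_mem_T_union_iff {r q : Fin (N + 2)}
    (hq : IsLeast {k | (D.vertex k).1 = (D.vertex r).1} q) (k : Fin (N + 2)) :
    D.vertex k ∈ D.T (D.vertex q) ∪ {D.vertex q} ↔ (D.vertex k).1 = (D.vertex r).1 := by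
  constructor
  · rintro (h | h)
    · exact ((D.point_mem_Lt_iff hq (D.mark_mem k)).1 h.2).2
    · rw [mem_singleton_iff.1 h]; exact hq.1
  · intro h
    by_cases hk : k = q
    · exact Or.inr (by rw [hk]; rfl)
    · exact Or.inl ⟨mem_range_self k, (D.point_mem_Lt_iff hq (D.mark_mem k)).2
        ⟨D.mark_strictMono.injective.ne hk, h⟩⟩

end CurvedDomain

/-! ### Integrability of $F$ and $F_1$. -/

namespace ControlProblem

variable {n m N : ℕ} (pb : ControlProblem n m) (D : CurvedDomain N)
  {x : ℝ × ℝ → Fin n → ℝ} {u : ℝ × ℝ → Fin m → ℝ}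

theorem contDiff_Φx (i : Fin n) : ContDiff ℝ 1 (pb.Φx i) :=
  (pb.contDiff_Φ.fderiv_right (by norm_num)).clm_apply contDiff_const

theorem contDiff_Φp (i : Fin n) : ContDiff ℝ 1 (pb.Φp i) :=
  (pb.contDiff_Φ.fderiv_right (by norm_num)).clm_apply contDiff_const

theorem contDiff_Φq (i : Fin n) : ContDiff ℝ 1 (pb.Φq i) :=
  (pb.contDiff_Φ.fderiv_right (by norm_num)).clm_apply contDiff_const

theorem contDiff_Φ₁x (i : Fin n) : ContDiff ℝ 1 (pb.Φ₁x i) :=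
  (pb.contDiff_Φ₁.fderiv_right (by norm_num)).clm_apply contDiff_const

theorem contDiff_Φ₁η (i : Fin n) : ContDiff ℝ 1 (pb.Φ₁η i) :=
  (pb.contDiff_Φ₁.fderiv_right (by norm_num)).clm_apply contDiff_const

variable {pb D}

theorem IsTrajectory.continuousOn_F (hx : pb.IsTrajectory D x u) (i : Fin n) :
    ContinuousOn (pb.F x u i) D.G := fun P hP => by
  have ha := contDiffAt_along (hx.contDiffAt_x P hP) (hx.contDiffAt_u P hP)
  refine ContinuousAt.continuousWithinAt (((?_ : ContinuousAt _ _).sub ?_).sub ?_)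
  · exact ((pb.contDiff_Φx i).contDiffAt.comp P ha).continuousAt
  · exact (contDiffAt_partialS (k := 0)
      ((pb.contDiff_Φp i).contDiffAt.comp P ha) (by norm_num)).continuousAt
  · exact (contDiffAt_partialT (k := 0)
      ((pb.contDiff_Φq i).contDiffAt.comp P ha) (by norm_num)).continuousAt

theorem IsTrajectory.integrableOn_F (hx : pb.IsTrajectory D x u) (i : Fin n) :
    IntegrableOn (pb.F x u i) D.G :=
  (hx.continuousOn_F i).integrableOn_compact D.isCompact_G

/-- On an arc between consecutive vertices, `F₁` extends continuously to the end points. -/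
theorem IsTrajectory.exists_continuousOn_eqOn_F₁ (hx : pb.IsTrajectory D x u) (i : Fin n)
    (r : Fin (N + 1)) :
    ∃ h : ℝ → ℝ, ContinuousOn h (Icc (D.mark r.castSucc) (D.mark r.succ)) ∧
      EqOn (pb.F₁ D x u i) h (Ioo (D.mark r.castSucc) (D.mark r.succ)) := by
  set I := Icc (D.mark r.castSucc) (D.mark r.succ) with hI
  have hu : UniqueDiffOn ℝ I := uniqueDiffOn_Icc (D.mark_lt r)
  obtain ⟨h₁, h₂⟩ := D.contDiff r
  -- Derivatives within the closed arc are $C^1$ up to its end points, where the two-sided `deriv`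
  -- need not exist or agree with them.
  set d₁ := derivWithin D.L₁ I
  set d₂ := derivWithin D.L₂ I
  have hd₁ : ContDiffOn ℝ 1 d₁ I := h₁.derivWithin hu (by norm_num)
  have hd₂ : ContDiffOn ℝ 1 d₂ I := h₂.derivWithin hu (by norm_num)
  have e : ∀ μ ∈ Ioo (D.mark r.castSucc) (D.mark r.succ), deriv D.L₁ μ = d₁ μ ∧
      deriv D.L₂ μ = d₂ μ := fun μ hμ =>
    ⟨(derivWithin_of_mem_nhds (Icc_mem_nhds hμ.1 hμ.2)).symm,
      (derivWithin_of_mem_nhds (Icc_mem_nhds hμ.1 hμ.2)).symm⟩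
  have hp : ContDiffOn ℝ 2 D.point I := h₁.prodMk h₂
  have hG : ∀ μ ∈ I, D.point μ ∈ D.G := fun μ hμ => D.point_mem_G (D.arc_subset r hμ)
  have hp1 : ContDiffOn ℝ 1 D.point I := hp.of_le (by norm_num)
  have hxp : ContDiffOn ℝ 1 (fun μ => x (D.point μ)) I := fun μ hμ =>
    ((hx.contDiffAt_x _ (hG μ hμ)).of_le (by norm_num)).comp_contDiffWithinAt μ (hp1 μ hμ)
  have hxs : ContDiffOn ℝ 1 (fun μ => partialS x (D.point μ)) I := fun μ hμ =>
    (contDiffAt_partialS (hx.contDiffAt_x _ (hG μ hμ)) (by norm_num)).comp_contDiffWithinAt μ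
      (hp1 μ hμ)
  have hxt : ContDiffOn ℝ 1 (fun μ => partialT x (D.point μ)) I := fun μ hμ =>
    (contDiffAt_partialT (hx.contDiffAt_x _ (hG μ hμ)) (by norm_num)).comp_contDiffWithinAt μ
      (hp1 μ hμ)
  have hal : ContDiffOn ℝ 1 (fun μ => along x u (D.point μ)) I := fun μ hμ =>
    (contDiffAt_along (hx.contDiffAt_x _ (hG μ hμ))
      (hx.contDiffAt_u _ (hG μ hμ))).comp_contDiffWithinAt μ (hp1 μ hμ)
  set c : ℝ → Arg₁ n := fun μ => (D.L₁ μ, D.L₂ μ, x (D.point μ),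
    d₁ μ • partialS x (D.point μ) + d₂ μ • partialT x (D.point μ)) with hc
  have hcI : ContDiffOn ℝ 1 c I := (h₁.of_le (by norm_num)).prodMk <|
    (h₂.of_le (by norm_num)).prodMk <| hxp.prodMk <| (hd₁.smul hxs).add (hd₂.smul hxt)
  have ec : EqOn (alongCurve D x) c (Ioo (D.mark r.castSucc) (D.mark r.succ)) := fun μ hμ => by
    simp only [alongCurve, hc, CurvedDomain.n₁, CurvedDomain.n₂, neg_neg, e μ hμ]
  have hΦc : ContDiffOn ℝ 1 (fun μ => pb.Φ₁η i (c μ)) I :=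
    (pb.contDiff_Φ₁η i).comp_contDiffOn hcI
  refine ⟨fun μ => d₂ μ * pb.Φp i (along x u (D.point μ))
      + (-d₁ μ) * pb.Φq i (along x u (D.point μ)) + pb.Φ₁x i (c μ)
      - derivWithin (fun ν => pb.Φ₁η i (c ν)) I μ, ?_, fun μ hμ => ?_⟩
  · refine (((hd₂.continuousOn.mul ?_).add (hd₁.continuousOn.neg.mul ?_)).add ?_).sub ?_
    · exact ((pb.contDiff_Φp i).comp_contDiffOn hal).continuousOn
    · exact ((pb.contDiff_Φq i).comp_contDiffOn hal).continuousOn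
    · exact ((pb.contDiff_Φ₁x i).comp_contDiffOn hcI).continuousOn
    · exact hΦc.continuousOn_derivWithin hu (by norm_num)
  -- Agreement on a neighbourhood, not only at `μ`, is needed to compare the derivatives along the
  -- curve.
  · have hev : (fun ν => pb.Φ₁η i (alongCurve D x ν)) =ᶠ[𝓝 μ] fun ν => pb.Φ₁η i (c ν) := by
      filter_upwards [Ioo_mem_nhds hμ.1 hμ.2] with ν hν
      rw [ec hν]
    simp only [F₁, CurvedDomain.n₁, CurvedDomain.n₂, e μ hμ, ec hμ, hev.deriv_eq,
      derivWithin_of_mem_nhds (hI ▸ Icc_mem_nhds hμ.1 hμ.2 : I ∈ 𝓝 μ)]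

theorem IsTrajectory.integrableOn_F₁ (hx : pb.IsTrajectory D x u) (i : Fin n) :
    IntegrableOn (pb.F₁ D x u i) (Icc 0 D.len) := by
  rw [← D.iUnion_arc, integrableOn_finite_iUnion]
  intro r
  obtain ⟨h, hc, heq⟩ := hx.exists_continuousOn_eqOn_F₁ i r
  -- The end points form a null set, so the values of `F₁` at the vertices are irrelevant.
  rw [integrableOn_Icc_iff_integrableOn_Ioo]
  exact ((hc.integrableOn_compact isCompact_Icc).mono_set Ioo_subset_Icc_self).congr_fun
    heq.symm measurableSet_Ioo

end ControlProblem

theorem HasJumpS.add {φ χ : ℝ × ℝ → ℝ} {P : ℝ × ℝ} {c d : ℝ} (hφ : HasJumpS φ P c)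
    (hχ : HasJumpS χ P d) : HasJumpS (fun Q => φ Q + χ Q) P (c + d) := by
  obtain ⟨a, b, ha, hb, rfl⟩ := hφ
  obtain ⟨a', b', ha', hb', rfl⟩ := hχ
  exact ⟨a + a', b + b', ha.add ha', hb.add hb', by ring⟩

theorem HasJumpT.add {φ χ : ℝ × ℝ → ℝ} {P : ℝ × ℝ} {c d : ℝ} (hφ : HasJumpT φ P c)
    (hχ : HasJumpT χ P d) : HasJumpT (fun Q => φ Q + χ Q) P (c + d) := by
  obtain ⟨a, b, ha, hb, rfl⟩ := hφ
  obtain ⟨a', b', ha', hb', rfl⟩ := hχ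
  exact ⟨a + a', b + b', ha.add ha', hb.add hb', by ring⟩

/-! ### Limits and jumps of integrals over $\{y\in A:Q\in W(pt(y))\}$. -/

section Integral

variable {N n : ℕ} {D : CurvedDomain N} {X : Type*} [TopologicalSpace X] [T2Space X]
  {A : Set X} {pt : X → ℝ × ℝ}

theorem isCompact_setOf_mem_rect_comp (hA : IsCompact A) (hpt : ContinuousOn pt A) (P : ℝ × ℝ) :
    IsCompact {y | y ∈ A ∧ P ∈ rect (pt y)} :=
  hA.of_isClosed_subset
    (hpt.preimage_isClosed_of_isClosed hA.isClosed (isClosed_setOf_mem_rect_left P)) fun _ h => h.1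

variable [MeasurableSpace X] [OpensMeasurableSpace X] {ν : Measure X}
  {g : Fin n → X → ℝ} {K : ℝ × ℝ → ℝ × ℝ → Fin n → ℝ}

theorem integrableOn_sum_mul_kernel (hA : IsCompact A) (hpt : ContinuousOn pt A)
    (hG : MapsTo pt A D.G) (hg : ∀ i, IntegrableOn (g i) A ν)
    (hK : ∀ i, ContinuousOn (fun z : (ℝ × ℝ) × (ℝ × ℝ) => K z.1 z.2 i)
      {z | z.1 ∈ D.G ∧ z.2 ∈ rect z.1}) (P : ℝ × ℝ) :
    IntegrableOn (fun y => ∑ i, g i y * K (pt y) P i) {y | y ∈ A ∧ P ∈ rect (pt y)} ν := by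
  refine integrable_finsetSum _ fun i _ => ?_
  refine IntegrableOn.mul_continuousOn ((hg i).mono_set fun y h => h.1) ?_
    (isCompact_setOf_mem_rect_comp hA hpt P)
  exact (hK i).comp ((hpt.mono fun y h => h.1).prodMk continuousOn_const) fun y h => ⟨hG h.1, h.2⟩

/-- `B` is the pointwise limit of the moving domains, as `hin` and `hout` express. Extending the
integrands by zero turns this into dominated convergence. -/
theorem tendsto_integral_sum_mul_kernel (hA : IsCompact A) (hpt : ContinuousOn pt A)
    (hG : MapsTo pt A D.G) (hg : ∀ i, IntegrableOn (g i) A ν)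
    (hK : ∀ i, ContinuousOn (fun z : (ℝ × ℝ) × (ℝ × ℝ) => K z.1 z.2 i)
      {z | z.1 ∈ D.G ∧ z.2 ∈ rect z.1})
    {ι : Type*} {l : Filter ι} [l.IsCountablyGenerated] {p : ι → ℝ × ℝ} {P : ℝ × ℝ}
    (hp : Tendsto p l (𝓝 P)) {B : Set X} (hB : MeasurableSet B)
    (hBA : B ⊆ {y | y ∈ A ∧ P ∈ rect (pt y)}) (hin : ∀ y ∈ B, ∀ᶠ τ in l, p τ ∈ rect (pt y))
    (hout : ∀ y ∈ A, y ∉ B → ∀ᶠ τ in l, p τ ∉ rect (pt y)) :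
    Tendsto (fun τ => ∫ y in {y | y ∈ A ∧ p τ ∈ rect (pt y)}, ∑ i, g i y * K (pt y) (p τ) i ∂ν) l
      (𝓝 (∫ y in B, ∑ i, g i y * K (pt y) P i ∂ν)) := by
  have hC : ∀ i, ∃ C, ∀ z ∈ {z : (ℝ × ℝ) × (ℝ × ℝ) | z.1 ∈ D.G ∧ z.2 ∈ rect z.1},
      ‖K z.1 z.2 i‖ ≤ C := fun i => D.isCompact_setOf_mem_rect.exists_bound_of_continuousOn (hK i)
  choose C hC using hC
  have hm : ∀ Q, MeasurableSet {y | y ∈ A ∧ Q ∈ rect (pt y)} := fun Q =>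
    (isCompact_setOf_mem_rect_comp hA hpt Q).measurableSet
  simp_rw [← fun τ => integral_indicator (μ := ν)
    (f := fun y => ∑ i, g i y * K (pt y) (p τ) i) (hm (p τ))]
  rw [← integral_indicator hB]
  refine tendsto_integral_filter_of_dominated_convergence
    (A.indicator fun y => ∑ i, ‖g i y‖ * C i) ?_ ?_ ?_ ?_
  · refine Eventually.of_forall fun τ => ?_
    exact ((integrable_indicator_iff (hm _)).2
      (integrableOn_sum_mul_kernel hA hpt hG hg hK (p τ))).aestronglyMeasurable
  · refine Eventually.of_forall fun τ => Eventually.of_forall fun y => ?_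
    by_cases hy : y ∈ {y | y ∈ A ∧ p τ ∈ rect (pt y)}
    · rw [indicator_of_mem hy, indicator_of_mem hy.1]
      refine (norm_sum_le _ _).trans (Finset.sum_le_sum fun i _ => ?_)
      rw [norm_mul]
      exact mul_le_mul_of_nonneg_left (hC i (pt y, p τ) ⟨hG hy.1, hy.2⟩) (norm_nonneg _)
    · rw [indicator_of_notMem hy, norm_zero]
      refine indicator_nonneg (fun y hyA => Finset.sum_nonneg fun i _ => ?_) y
      -- The sign of `C i` is known only through a point where it bounds a norm. Such a point exists
      -- because the rectangle of a point of $G$ contains the origin.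
      rcases (rect (pt y)).eq_empty_or_nonempty with he | ⟨Q, hQ⟩
      · obtain ⟨T, -, hT⟩ := hG hyA
        exact absurd (show (0, 0) ∈ rect (pt y) from ⟨le_rfl, hT.1, le_rfl, hT.2.2.1⟩)
          (he ▸ notMem_empty _)
      · exact mul_nonneg (norm_nonneg _) ((norm_nonneg _).trans (hC i (pt y, Q) ⟨hG hyA, hQ⟩))
  · refine (integrable_indicator_iff hA.measurableSet).2 (integrable_finsetSum _ fun i _ => ?_)
    exact (hg i).norm.mul_const _
  · refine Eventually.of_forall fun y => ?_
    by_cases hy : y ∈ B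
    · rw [indicator_of_mem hy]
      have hyA := (hBA hy).1
      have hlim : Tendsto (fun τ => ∑ i, g i y * K (pt y) (p τ) i) l
          (𝓝 (∑ i, g i y * K (pt y) P i)) := by
        refine tendsto_finsetSum _ fun i _ => Tendsto.const_mul _ ?_
        refine Tendsto.comp (hK i (pt y, P) ⟨hG hyA, (hBA hy).2⟩)
          (tendsto_nhdsWithin_iff.2 ⟨tendsto_const_nhds.prodMk_nhds hp, ?_⟩)
        exact (hin y hy).mono fun τ hτ => ⟨hG hyA, hτ⟩
      refine hlim.congr' ((hin y hy).mono fun τ hτ => ?_)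
      exact (indicator_of_mem (s := {y | y ∈ A ∧ p τ ∈ rect (pt y)}) ⟨hyA, hτ⟩
        fun y => ∑ i, g i y * K (pt y) (p τ) i).symm
    · rw [indicator_of_notMem hy]
      refine tendsto_const_nhds.congr' ?_
      by_cases hyA : y ∈ A
      · exact (hout y hyA hy).mono fun τ hτ => (indicator_of_notMem (s := {y | y ∈ A ∧ p τ ∈ rect (pt y)})
          (fun h => hτ h.2) _).symm
      · exact Eventually.of_forall fun τ => (indicator_of_notMem (s := {y | y ∈ A ∧ p τ ∈ rect (pt y)})
          (fun h => hyA h.1) _).symm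

/-- The limit domain from below contains the line $t=t(P)$, the one from above does not; nothing
else differs. Positivity of `P.2` keeps nearby points above the $s$-axis, as membership in a
rectangle requires. -/
theorem hasJumpS_integral (hA : IsCompact A) (hpt : ContinuousOn pt A)
    (hG : MapsTo pt A D.G) (hg : ∀ i, IntegrableOn (g i) A ν)
    (hK : ∀ i, ContinuousOn (fun z : (ℝ × ℝ) × (ℝ × ℝ) => K z.1 z.2 i)
      {z | z.1 ∈ D.G ∧ z.2 ∈ rect z.1}) {P : ℝ × ℝ} (hP : 0 < P.2) :
    HasJumpS (fun Q => ∫ y in {y | y ∈ A ∧ Q ∈ rect (pt y)}, ∑ i, g i y * K (pt y) Q i ∂ν) P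
      (∫ y in {y | (y ∈ A ∧ P ∈ rect (pt y)) ∧ (pt y).2 = P.2},
        ∑ i, g i y * K (pt y) P i ∂ν) := by
  have hc := isCompact_setOf_mem_rect_comp hA hpt P
  have hpc : ContinuousOn (fun y => (pt y).2) {y | y ∈ A ∧ P ∈ rect (pt y)} :=
    continuous_snd.comp_continuousOn (hpt.mono fun y h => h.1)
  have heq : MeasurableSet {y | (y ∈ A ∧ P ∈ rect (pt y)) ∧ (pt y).2 = P.2} :=
    (hpc.preimage_isClosed_of_isClosed hc.isClosed (isClosed_singleton (x := P.2))).measurableSet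
  have hdiff : {y | y ∈ A ∧ P ∈ rect (pt y)} \
      {y | (y ∈ A ∧ P ∈ rect (pt y)) ∧ (pt y).2 = P.2} =
      {y | (y ∈ A ∧ P ∈ rect (pt y)) ∧ P.2 < (pt y).2} := by
    ext y
    constructor
    · rintro ⟨h, h'⟩
      exact ⟨h, h.2.2.2.2.lt_of_ne' fun e => h' ⟨h, e⟩⟩
    · rintro ⟨h, h'⟩
      exact ⟨h, fun e => h'.ne' e.2⟩
  have hpath : Tendsto (fun τ => (P.1, τ)) (𝓝 P.2) (𝓝 P) :=
    (by fun_prop : Continuous fun τ : ℝ => (P.1, τ)).tendsto P.2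
  refine ⟨_, _, tendsto_integral_sum_mul_kernel hA hpt hG hg hK
    (hpath.mono_left nhdsWithin_le_nhds) hc.measurableSet subset_rfl ?_ ?_,
    tendsto_integral_sum_mul_kernel hA hpt hG hg hK (hpath.mono_left nhdsWithin_le_nhds)
    (hdiff ▸ hc.measurableSet.diff heq) (fun y h => h.1) ?_ ?_, ?_⟩
  · rintro y ⟨-, h⟩
    filter_upwards [nhdsWithin_le_nhds (Ioi_mem_nhds hP), self_mem_nhdsWithin] with τ h0 h1
    exact ⟨h.1, h.2.1, le_of_lt h0, (le_of_lt h1).trans h.2.2.2⟩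
  · intro y hy hyB
    by_cases h1 : 0 ≤ P.1 ∧ P.1 ≤ (pt y).1
    · have : (pt y).2 < P.2 := by
        by_contra! h
        exact hyB ⟨hy, h1.1, h1.2, hP.le, h⟩
      filter_upwards [nhdsWithin_le_nhds (Ioi_mem_nhds this)] with τ hτ h
      exact h.2.2.2.not_gt hτ
    · exact Eventually.of_forall fun τ h => h1 ⟨h.1, h.2.1⟩
  · rintro y ⟨⟨-, h⟩, hlt⟩
    filter_upwards [nhdsWithin_le_nhds (Ioi_mem_nhds hP),
      nhdsWithin_le_nhds (Iio_mem_nhds hlt)] with τ h0 h1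
    exact ⟨h.1, h.2.1, le_of_lt h0, le_of_lt h1⟩
  · intro y hy hyB
    filter_upwards [self_mem_nhdsWithin] with τ hτ h
    have hlt : P.2 < (pt y).2 := lt_of_lt_of_le hτ h.2.2.2
    exact hyB ⟨⟨hy, h.1, h.2.1, hP.le, hlt.le⟩, hlt⟩
  · rw [← hdiff, setIntegral_sdiff heq (integrableOn_sum_mul_kernel hA hpt hG hg hK P)
      (fun y h => h.1), sub_sub_cancel]

theorem hasJumpT_integral (hA : IsCompact A) (hpt : ContinuousOn pt A)
    (hG : MapsTo pt A D.G) (hg : ∀ i, IntegrableOn (g i) A ν)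
    (hK : ∀ i, ContinuousOn (fun z : (ℝ × ℝ) × (ℝ × ℝ) => K z.1 z.2 i)
      {z | z.1 ∈ D.G ∧ z.2 ∈ rect z.1}) {P : ℝ × ℝ} (hP : 0 < P.1) :
    HasJumpT (fun Q => ∫ y in {y | y ∈ A ∧ Q ∈ rect (pt y)}, ∑ i, g i y * K (pt y) Q i ∂ν) P
      (∫ y in {y | (y ∈ A ∧ P ∈ rect (pt y)) ∧ (pt y).1 = P.1},
        ∑ i, g i y * K (pt y) P i ∂ν) := by
  have hc := isCompact_setOf_mem_rect_comp hA hpt P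
  have hpc : ContinuousOn (fun y => (pt y).1) {y | y ∈ A ∧ P ∈ rect (pt y)} :=
    continuous_fst.comp_continuousOn (hpt.mono fun y h => h.1)
  have heq : MeasurableSet {y | (y ∈ A ∧ P ∈ rect (pt y)) ∧ (pt y).1 = P.1} :=
    (hpc.preimage_isClosed_of_isClosed hc.isClosed (isClosed_singleton (x := P.1))).measurableSet
  have hdiff : {y | y ∈ A ∧ P ∈ rect (pt y)} \
      {y | (y ∈ A ∧ P ∈ rect (pt y)) ∧ (pt y).1 = P.1} =
      {y | (y ∈ A ∧ P ∈ rect (pt y)) ∧ P.1 < (pt y).1} := by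
    ext y
    constructor
    · rintro ⟨h, h'⟩
      exact ⟨h, h.2.2.1.lt_of_ne' fun e => h' ⟨h, e⟩⟩
    · rintro ⟨h, h'⟩
      exact ⟨h, fun e => h'.ne' e.2⟩
  have hpath : Tendsto (fun σ => (σ, P.2)) (𝓝 P.1) (𝓝 P) :=
    (by fun_prop : Continuous fun σ : ℝ => (σ, P.2)).tendsto P.1
  refine ⟨_, _, tendsto_integral_sum_mul_kernel hA hpt hG hg hK
    (hpath.mono_left nhdsWithin_le_nhds) hc.measurableSet subset_rfl ?_ ?_,
    tendsto_integral_sum_mul_kernel hA hpt hG hg hK (hpath.mono_left nhdsWithin_le_nhds)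
    (hdiff ▸ hc.measurableSet.diff heq) (fun y h => h.1) ?_ ?_, ?_⟩
  · rintro y ⟨-, h⟩
    filter_upwards [nhdsWithin_le_nhds (Ioi_mem_nhds hP), self_mem_nhdsWithin] with σ h0 h1
    exact ⟨le_of_lt h0, (le_of_lt h1).trans h.2.1, h.2.2⟩
  · intro y hy hyB
    by_cases h1 : 0 ≤ P.2 ∧ P.2 ≤ (pt y).2
    · have : (pt y).1 < P.1 := by
        by_contra! h
        exact hyB ⟨hy, hP.le, h, h1⟩
      filter_upwards [nhdsWithin_le_nhds (Ioi_mem_nhds this)] with σ hσ h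
      exact h.2.1.not_gt hσ
    · exact Eventually.of_forall fun σ h => h1 h.2.2
  · rintro y ⟨⟨-, h⟩, hlt⟩
    filter_upwards [nhdsWithin_le_nhds (Ioi_mem_nhds hP),
      nhdsWithin_le_nhds (Iio_mem_nhds hlt)] with σ h0 h1
    exact ⟨le_of_lt h0, le_of_lt h1, h.2.2⟩
  · intro y hy hyB
    filter_upwards [self_mem_nhdsWithin] with σ hσ h
    have hlt : P.1 < (pt y).1 := lt_of_lt_of_le hσ h.2.1
    exact hyB ⟨⟨hy, hP.le, hlt.le, h.2.2⟩, hlt⟩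
  · rw [← hdiff, setIntegral_sdiff heq (integrableOn_sum_mul_kernel hA hpt hG hg hK P)
      (fun y h => h.1), sub_sub_cancel]

end Integral

/-! ### The part of the curve that carries the jump. -/

namespace CurvedDomain

variable {N : ℕ} (D : CurvedDomain N)

theorem params_arc (P : ℝ × ℝ) :
    D.params (D.arc P) = {μ | μ ∈ Icc 0 D.len ∧ P ∈ rect (D.point μ)} := by
  ext μ
  exact ⟨fun h => ⟨h.1, h.2.2⟩, fun h => ⟨h.1, mem_image_of_mem _ h.1, h.2⟩⟩

/-- The two sets differ at most at the parameter of $P_q$, which `Ls` excludes; the rectangle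
condition is automatic by `lt_L₁_of_L₂_eq`. -/
theorem params_Ls_ae_eq {r q : Fin (N + 2)}
    (hq : IsGreatest {k | (D.vertex k).2 = (D.vertex r).2} q) {P : ℝ × ℝ}
    (hP : P ∈ interior D.G) (hPr : P.2 = (D.vertex r).2) :
    {μ | (μ ∈ Icc 0 D.len ∧ P ∈ rect (D.point μ)) ∧ (D.point μ).2 = P.2} =ᵐ[volume]
      D.params (D.Ls (D.vertex q)) := by
  filter_upwards [Measure.ae_ne volume (D.mark q)] with μ hne
  refine propext ⟨fun h => ⟨h.1.1, (D.point_mem_Ls_iff hq h.1.1).2 ⟨hne, h.2.trans hPr⟩⟩,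
    fun h => ?_⟩
  have h2 : D.L₂ μ = P.2 := ((D.point_mem_Ls_iff hq h.1).1 h.2).2.trans hPr.symm
  have h0 := D.exists_point_gt hP
  exact ⟨⟨h.1, h0.1.le, (D.lt_L₁_of_L₂_eq hP h.1 h2).le, h0.2.1.le, h2.ge⟩, h2⟩

theorem params_Lt_ae_eq {r q : Fin (N + 2)}
    (hq : IsLeast {k | (D.vertex k).1 = (D.vertex r).1} q) {P : ℝ × ℝ}
    (hP : P ∈ interior D.G) (hPr : P.1 = (D.vertex r).1) :
    {μ | (μ ∈ Icc 0 D.len ∧ P ∈ rect (D.point μ)) ∧ (D.point μ).1 = P.1} =ᵐ[volume]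
      D.params (D.Lt (D.vertex q)) := by
  filter_upwards [Measure.ae_ne volume (D.mark q)] with μ hne
  refine propext ⟨fun h => ⟨h.1.1, (D.point_mem_Lt_iff hq h.1.1).2 ⟨hne, h.2.trans hPr⟩⟩,
    fun h => ?_⟩
  have h1 : D.L₁ μ = P.1 := ((D.point_mem_Lt_iff hq h.1).1 h.2).2.trans hPr.symm
  have h0 := D.exists_point_gt hP
  exact ⟨⟨h.1, h0.1.le, h1.ge, h0.2.1.le, (D.lt_L₂_of_L₁_eq hP h.1 h1).le⟩, h1⟩

theorem vertex_zero : D.vertex 0 = (D.a, 0) := by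
  rw [vertex, D.mark_zero, point, D.start_eq.1, D.start_eq.2]

theorem vertex_last : D.vertex (Fin.last (N + 1)) = (0, D.b) := by
  rw [vertex, D.mark_last, point, D.end_eq.1, D.end_eq.2]

theorem snd_lt_b {P : ℝ × ℝ} (hP : P ∈ interior D.G) : P.2 < D.b := by
  obtain ⟨-, -, ν, hν, -, h⟩ := D.exists_point_gt hP
  exact h.trans_le (D.point_le hν).2

theorem fst_lt_a {P : ℝ × ℝ} (hP : P ∈ interior D.G) : P.1 < D.a := by
  obtain ⟨-, -, ν, hν, h, -⟩ := D.exists_point_gt hP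
  exact h.trans_le (D.point_le hν).1

end CurvedDomain

theorem volume_setOf_snd_eq (c : ℝ) : volume {Q : ℝ × ℝ | Q.2 = c} = 0 := by
  have : {Q : ℝ × ℝ | Q.2 = c} = univ ×ˢ {c} := by ext Q; simp
  rw [this, Measure.volume_eq_prod, Measure.prod_prod, Real.volume_singleton, mul_zero]

theorem volume_setOf_fst_eq (c : ℝ) : volume {Q : ℝ × ℝ | Q.1 = c} = 0 := by
  have : {Q : ℝ × ℝ | Q.1 = c} = {c} ×ˢ univ := by ext Q; simp
  rw [this, Measure.volume_eq_prod, Measure.prod_prod, Real.volume_singleton, zero_mul]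

theorem setIntegral_count {ι : Type*} [Fintype ι] [MeasurableSpace ι] [MeasurableSingletonClass ι]
    (s : Set ι) [DecidablePred (· ∈ s)] (f : ι → ℝ) :
    ∫ k in s, f k ∂Measure.count = ∑ k, if k ∈ s then f k else 0 := by
  rw [← integral_indicator s.toFinite.measurableSet, integral_count]
  exact Finset.sum_congr rfl fun k _ => indicator_apply s f k

/-- A sum over all vertices whose terms at the two end points vanish. -/
theorem sum_vertices_eq_sum_inner {N : ℕ} {f : Fin (N + 2) → ℝ} (h0 : f 0 = 0)
    (hlast : f (Fin.last (N + 1)) = 0) : ∑ k, f k = ∑ k : Fin N, f k.succ.castSucc := by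
  rw [Fin.sum_univ_castSucc, Fin.sum_univ_succ, hlast, Fin.castSucc_zero, h0, add_zero, zero_add]

/-! ### Assembly of the jumps of the co-state. -/

namespace ControlProblem

variable {n m N : ℕ} {pb : ControlProblem n m} {D : CurvedDomain N}
  {x : ℝ × ℝ → Fin n → ℝ} {u : ℝ × ℝ → Fin m → ℝ}
  {R : ℝ × ℝ → ℝ × ℝ → Matrix (Fin n) (Fin n) ℝ}

theorem IsRiemannMatrix.continuousOn (hR : pb.IsRiemannMatrix D x u R) (i j : Fin n) :
    ContinuousOn (fun z : (ℝ × ℝ) × (ℝ × ℝ) => R z.1 z.2 i j)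
      {z | z.1 ∈ D.G ∧ z.2 ∈ rect z.1} := by
  obtain ⟨_, _, h, -⟩ := hR
  exact (h i j).1

/-- Writing the vertex sum as an integral against counting measure lets one jump lemma serve all
three terms. -/
theorem costate_eq (j : Fin n) : pb.costate D x u R j = fun P =>
    ((∫ Q in {Q | Q ∈ D.G ∧ P ∈ rect Q}, ∑ i, pb.F x u i Q * R Q P i j)
    + (∫ μ in {μ | μ ∈ Icc 0 D.len ∧ P ∈ rect (D.point μ)},
        ∑ i, pb.F₁ D x u i μ * R (D.point μ) P i j))
    + ∫ k in {k : Fin N | k ∈ univ ∧ P ∈ rect (D.vertex k.succ.castSucc)},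
        ∑ i, pb.F₀ D x i k.succ.castSucc * R (D.vertex k.succ.castSucc) P i j
          ∂Measure.count := by
  classical
  funext P
  rw [costate, D.params_arc, setIntegral_count]
  congr 1
  refine Finset.sum_congr rfl fun k _ => ?_
  rw [← Finset.sum_mul, mul_ite, mul_one, mul_zero]
  exact if_congr (by simp) rfl rfl

theorem IsTrajectory.integrableOn_costate (hx : pb.IsTrajectory D x u)
    (hR : pb.IsRiemannMatrix D x u R) (j : Fin n) (P : ℝ × ℝ) :
    IntegrableOn (fun Q => ∑ i, pb.F x u i Q * R Q P i j) (D.E P) ∧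
      IntegrableOn (fun μ => ∑ i, pb.F₁ D x u i μ * R (D.point μ) P i j)
        (D.params (D.arc P)) := by
  refine ⟨?_, ?_⟩
  · exact integrableOn_sum_mul_kernel (pt := fun Q => Q) (K := fun Q P i => R Q P i j)
      D.isCompact_G continuousOn_id (mapsTo_id _) hx.integrableOn_F
      (fun i => hR.continuousOn i j) P
  · rw [D.params_arc]
    exact integrableOn_sum_mul_kernel (K := fun Q P i => R Q P i j) isCompact_Icc
      D.continuousOn_point (fun μ hμ => D.point_mem_G hμ) hx.integrableOn_F₁
      (fun i => hR.continuousOn i j) P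

open Classical in
theorem IsTrajectory.hasJumpS_costate (hx : pb.IsTrajectory D x u)
    (hR : pb.IsRiemannMatrix D x u R) (j : Fin n) {r q : Fin (N + 2)}
    (hq : IsGreatest {k | (D.vertex k).2 = (D.vertex r).2} q) {P : ℝ × ℝ}
    (hP : P ∈ interior D.G) (hPr : P.2 = (D.vertex r).2) :
    HasJumpS (pb.costate D x u R j) P
      ((∫ μ in D.params (D.Ls (D.vertex q)), ∑ i, pb.F₁ D x u i μ * R (D.point μ) P i j)
        + ∑ k with D.vertex k ∈ D.S (D.vertex q) ∪ {D.vertex q},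
            ∑ i, pb.F₀ D x i k * R (D.vertex k) P i j) := by
  obtain ⟨h1, h2, -⟩ := D.exists_point_gt hP
  have hK := fun i => hR.continuousOn i j
  have jump := ((hasJumpS_integral (pt := fun Q => Q) (K := fun Q P i => R Q P i j)
      D.isCompact_G continuousOn_id (mapsTo_id _) hx.integrableOn_F hK h2).add
    (hasJumpS_integral (K := fun Q P i => R Q P i j) isCompact_Icc D.continuousOn_point
      (fun μ hμ => D.point_mem_G hμ) hx.integrableOn_F₁ hK h2)).add
    (hasJumpS_integral (ν := Measure.count) (K := fun Q P i => R Q P i j)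
      (pt := fun k : Fin N => D.vertex k.succ.castSucc)
      (g := fun i k => pb.F₀ D x i k.succ.castSucc) finite_univ.isCompact
      continuous_of_discreteTopology.continuousOn (fun k _ => D.point_mem_G (D.mark_mem _))
      (fun i => Integrable.of_finite) hK h2)
  rw [costate_eq]
  convert jump using 1
  -- The area term does not jump, because a line is a null set in the plane.
  rw [setIntegral_measure_zero _ (measure_mono_null (fun Q h => h.2) (volume_setOf_snd_eq P.2)),
    zero_add, setIntegral_congr_set (D.params_Ls_ae_eq hq hP hPr), setIntegral_count,
    Finset.sum_filter]
  congr 1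
  simp_rw [D.vertex_mem_S_union_iff hq, ← hPr]
  -- The co-state omits $P_0$ and $P_{N+1}$. Their heights $0$ and $b$ differ from that of an
  -- interior point, so they contribute nothing to the full sum either.
  rw [sum_vertices_eq_sum_inner]
  · refine Finset.sum_congr rfl fun k _ => if_congr ⟨fun h => ?_, fun h => h.2⟩ rfl rfl
    exact ⟨⟨mem_univ _, h1.le, (D.lt_L₁_of_L₂_eq hP (D.mark_mem _) h).le, h2.le, h.ge⟩, h⟩
  · rw [D.vertex_zero, if_neg h2.ne]
  · rw [D.vertex_last, if_neg (D.snd_lt_b hP).ne']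

open Classical in
theorem IsTrajectory.hasJumpT_costate (hx : pb.IsTrajectory D x u)
    (hR : pb.IsRiemannMatrix D x u R) (j : Fin n) {r q : Fin (N + 2)}
    (hq : IsLeast {k | (D.vertex k).1 = (D.vertex r).1} q) {P : ℝ × ℝ}
    (hP : P ∈ interior D.G) (hPr : P.1 = (D.vertex r).1) :
    HasJumpT (pb.costate D x u R j) P
      ((∫ μ in D.params (D.Lt (D.vertex q)), ∑ i, pb.F₁ D x u i μ * R (D.point μ) P i j)
        + ∑ k with D.vertex k ∈ D.T (D.vertex q) ∪ {D.vertex q},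
            ∑ i, pb.F₀ D x i k * R (D.vertex k) P i j) := by
  obtain ⟨h1, h2, -⟩ := D.exists_point_gt hP
  have hK := fun i => hR.continuousOn i j
  have jump := ((hasJumpT_integral (pt := fun Q => Q) (K := fun Q P i => R Q P i j)
      D.isCompact_G continuousOn_id (mapsTo_id _) hx.integrableOn_F hK h1).add
    (hasJumpT_integral (K := fun Q P i => R Q P i j) isCompact_Icc D.continuousOn_point
      (fun μ hμ => D.point_mem_G hμ) hx.integrableOn_F₁ hK h1)).add
    (hasJumpT_integral (ν := Measure.count) (K := fun Q P i => R Q P i j)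
      (pt := fun k : Fin N => D.vertex k.succ.castSucc)
      (g := fun i k => pb.F₀ D x i k.succ.castSucc) finite_univ.isCompact
      continuous_of_discreteTopology.continuousOn (fun k _ => D.point_mem_G (D.mark_mem _))
      (fun i => Integrable.of_finite) hK h1)
  rw [costate_eq]
  convert jump using 1
  rw [setIntegral_measure_zero _ (measure_mono_null (fun Q h => h.2) (volume_setOf_fst_eq P.1)),
    zero_add, setIntegral_congr_set (D.params_Lt_ae_eq hq hP hPr), setIntegral_count,
    Finset.sum_filter]
  congr 1
  simp_rw [D.vertex_mem_T_union_iff hq, ← hPr]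
  -- Here the end vertices drop out because an interior point has $0<s<a$.
  rw [sum_vertices_eq_sum_inner]
  · refine Finset.sum_congr rfl fun k _ => if_congr ⟨fun h => ?_, fun h => h.2⟩ rfl rfl
    exact ⟨⟨mem_univ _, h1.le, h.ge, h2.le, (D.lt_L₂_of_L₁_eq hP (D.mark_mem _) h).le⟩, h⟩
  · rw [D.vertex_zero, if_neg (D.fst_lt_a hP).ne']
  · rw [D.vertex_last, if_neg h1.ne]

end ControlProblem

end GoursatDarboux

open Classical in
theorem theorem4p3 {n m N : ℕ} (D : GoursatDarboux.CurvedDomain N)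
    (pb : GoursatDarboux.ControlProblem n m)
    (x : ℝ × ℝ → Fin n → ℝ) (u : ℝ × ℝ → Fin m → ℝ) (hx : pb.IsTrajectory D x u)
    (R : ℝ × ℝ → ℝ × ℝ → Matrix (Fin n) (Fin n) ℝ) (hR : pb.IsRiemannMatrix D x u R)
    (j : Fin n) :
    -- all integrals that occur converge
    (∀ P ∈ D.G,
      IntegrableOn (fun Q => ∑ i, pb.F x u i Q * R Q P i j) (D.E P) ∧
      IntegrableOn (fun μ => ∑ i, pb.F₁ D x u i μ * R (D.point μ) P i j) (D.params (D.arc P))) ∧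
    -- jump across `(S_r)`, where `P_q` is the last vertex on the line `t = t(P_r)`
    (∀ r q : Fin (N + 2), IsGreatest {k | (D.vertex k).2 = (D.vertex r).2} q →
      ∀ P ∈ interior D.G, P.2 = (D.vertex r).2 →
        GoursatDarboux.HasJumpS (pb.costate D x u R j) P
          ((∫ μ in D.params (D.Ls (D.vertex q)),
              ∑ i, pb.F₁ D x u i μ * R (D.point μ) P i j)
            + ∑ k with D.vertex k ∈ D.S (D.vertex q) ∪ {D.vertex q},
                ∑ i, pb.F₀ D x i k * R (D.vertex k) P i j)) ∧
    -- jump across `(T_r)`, where `P_q` is the first vertex on the line `s = s(P_r)`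
    (∀ r q : Fin (N + 2), IsLeast {k | (D.vertex k).1 = (D.vertex r).1} q →
      ∀ P ∈ interior D.G, P.1 = (D.vertex r).1 →
        GoursatDarboux.HasJumpT (pb.costate D x u R j) P
          ((∫ μ in D.params (D.Lt (D.vertex q)),
              ∑ i, pb.F₁ D x u i μ * R (D.point μ) P i j)
            + ∑ k with D.vertex k ∈ D.T (D.vertex q) ∪ {D.vertex q},
                ∑ i, pb.F₀ D x i k * R (D.vertex k) P i j)) := by
  exact ⟨fun P _ => hx.integrableOn_costate hR j P,
    fun r q hq P hP hPr => hx.hasJumpS_costate hR j hq hP hPr,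
    fun r q hq P hP hPr => hx.hasJumpT_costate hR j hq hP hPr⟩
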